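/- Let $k \ge 0$ and $l \ge 2$ be integers, let $\lambda_1,\dots,\lambda_k$ be quaternions with $|\lambda_i| = 1$, and let $\tilde\gamma \in \mathrm{PSL}(k+l,\mathbb{H})$ have a lift $\gamma \in \mathrm{SL}(k+l,\mathbb{H})$ of the block diagonal form $$\gamma = \begin{bmatrix} \mathrm{D}(\lambda_1,\dots,\lambda_k) & \\ & \mathrm{J}(1,l)\end{bmatrix},$$ where $\mathrm{D}(\lambda_1,\dots,\lambda_k)$ is the diagonal matrix with entries $\lambda_1,\dots,\lambda_k$ and $\mathrm{J}(1,l)$ is the $l\times l$ matrix with $1$ on the diagonal and on the superdiagonal and $0$ elsewhere. Here $\mathrm{SL}(n,\mathbb{H})$ is the group of quaternionic $n\times n$ matrices $A = A_1 + A_2 j$ ($A_1, A_2$ complex) with $\det\begin{bmatrix} A_1 & A_2\\ -\overline{A_2} & \overline{A_1}\end{bmatrix} = 1$, and $\mathrm{PSL}(n,\mathbb{H})$ is its quotient by its centre; it acts by left multiplication on the projective space $\mathbb{P}^{n-1}_{\mathbb{H}} = (\mathbb{H}^n\setminus\{0\})/\mathbb{H}^\times$ of the right $\mathbb{H}$-module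 $\mathbb{H}^n$, which carries the quotient topology. For a group $G$ acting on a topological space $X$, a point $p$ is a cluster point of a family $(A_\beta)_{\beta\in B}$ of subsets of $X$ if every neighbourhood of $p$ meets $A_\beta$ for infinitely many indices $\beta$. Let $L_0(G)$ be the closure of the set of points with infinite isotropy group, $L_1(G)$ the closure of the set of cluster points of the orbits $(gx)_{g\in G}$ of points $x\in X\setminus L_0(G)$, and $L_2(G)$ the closure of the set of cluster points of the families $(g(K))_{g\in G}$, where $K$ runs over the compact subsets of $X\setminus(L_0(G)\cup L_1(G))$. The Kulkarni limit set of $G$ is $\Lambda_{Kul}(G) = L_0(G)\cup L_1(G)\cup L_2(G)$. Then, for the cyclic group $G = \langle\tilde\gamma\rangle$ acting on $X = \mathbb{P}^{k+l-1}_{\mathbb{H}}$, $$\Lambda_{Kul}(G) = L\{e_1,\dots,e_{k+l-1}\},$$ the projective subspace spanned by the points $e_1,\dots,e_{k+l-1}$ of $\mathbb{P}^{k+l-1}_{\mathbb{H}}$ given by the first $k+l-1$ standard basis vectors of $\mathbb{H}^{k+l}$. -/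

import Mathlib

open scoped Quaternion Matrix LinearAlgebra.Projectivization Topology

noncomputable section

/-! ### Kulkarni limit sets of a group acting on a topological space -/

namespace Kulkarni

/-- `p` is a cluster point of the family of sets `(A β)_{β ∈ B}`: every neighbourhood of `p` meets
`A β` for infinitely many indices `β`. -/
def IsClusterPoint {X B : Type*} [TopologicalSpace X] (A : B → Set X) (p : X) : Prop :=
  ∀ U ∈ 𝓝 p, {β : B | (U ∩ A β).Nonempty}.Infinite

variable (G X : Type*) [Group G] [MulAction G X] [TopologicalSpace X]

/-- The closure of the set of points with infinite isotropy group. -/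
def L0 : Set X := closure {x : X | Infinite (MulAction.stabilizer G x)}

/-- The closure of the set of cluster points of the orbits `(g x)_{g ∈ G}`, with `x` outside
`L0`. -/
def L1 : Set X :=
  closure {p : X | ∃ x ∈ (L0 G X)ᶜ, IsClusterPoint (fun g : G => ({g • x} : Set X)) p}

/-- The closure of the set of cluster points of the families `(g K)_{g ∈ G}`, with `K` a compact
subset of the complement of `L0 ∪ L1`. -/
def L2 : Set X :=
  closure {p : X | ∃ K : Set X, IsCompact K ∧ K ⊆ (L0 G X ∪ L1 G X)ᶜ ∧
    IsClusterPoint (fun g : G => (fun x => g • x) '' K) p}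

/-- The Kulkarni limit set of `G` acting on `X`. -/
def limitSet : Set X := L0 G X ∪ L1 G X ∪ L2 G X

end Kulkarni

/-! ### Quaternionic projective space and the groups `SL(n, ℍ)`, `PSL(n, ℍ)` -/

namespace QuatProj

/-- The projective space `(ℍⁿ ∖ {0}) / ℍ^×` of the right `ℍ`-module `ℍⁿ`; it has
quaternionic dimension `n - 1`. A right `ℍ`-module is a left module over the opposite ring. -/
abbrev Space (n : ℕ) : Type := ℙ (ℍ[ℝ])ᵐᵒᵖ (Fin n → ℍ[ℝ])

/-- The quotient topology from `ℍⁿ ∖ {0}`. -/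
instance (n : ℕ) : TopologicalSpace (Space n) :=
  TopologicalSpace.coinduced
    (Projectivization.mk' (ℍ[ℝ])ᵐᵒᵖ : {v : Fin n → ℍ[ℝ] // v ≠ 0} → Space n) inferInstance

/-- The point of projective space given by the `i`-th standard basis vector. -/
def stdPoint {n : ℕ} (i : Fin n) : Space n :=
  Projectivization.mk (ℍ[ℝ])ᵐᵒᵖ (Pi.single i (1 : ℍ[ℝ])) (by simp)

/-- The first complex coordinate `z` of `q = z + w j`. -/
def fstC (q : ℍ[ℝ]) : ℂ := ⟨q.re, q.imI⟩

/-- The second complex coordinate `w` of `q = z + w j`. -/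
def sndC (q : ℍ[ℝ]) : ℂ := ⟨q.imJ, q.imK⟩

/-- Writing `A = A₁ + A₂ j` with complex `A₁, A₂`, the `2n × 2n` complex matrix
`[A₁, A₂; -conj A₂, conj A₁]`. -/
def complexify {n : ℕ} (A : Matrix (Fin n) (Fin n) ℍ[ℝ]) :
    Matrix (Fin n ⊕ Fin n) (Fin n ⊕ Fin n) ℂ :=
  Matrix.fromBlocks (A.map fstC) (A.map sndC)
    (A.map fun q => -(starRingEnd ℂ) (sndC q)) (A.map fun q => (starRingEnd ℂ) (fstC q))

theorem fstC_sum {ι : Type*} (s : Finset ι) (f : ι → ℍ[ℝ]) :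
    fstC (∑ i ∈ s, f i) = ∑ i ∈ s, fstC (f i) :=
  map_sum (⟨⟨fstC, rfl⟩, fun _ _ => rfl⟩ : ℍ[ℝ] →+ ℂ) f s

theorem sndC_sum {ι : Type*} (s : Finset ι) (f : ι → ℍ[ℝ]) :
    sndC (∑ i ∈ s, f i) = ∑ i ∈ s, sndC (f i) :=
  map_sum (⟨⟨sndC, rfl⟩, fun _ _ => rfl⟩ : ℍ[ℝ] →+ ℂ) f s

theorem fstC_mul (p q : ℍ[ℝ]) :
    fstC (p * q) = fstC p * fstC q - sndC p * (starRingEnd ℂ) (sndC q) := by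
  apply Complex.ext <;> simp [fstC, sndC] <;> ring

theorem sndC_mul (p q : ℍ[ℝ]) :
    sndC (p * q) = fstC p * sndC q + sndC p * (starRingEnd ℂ) (fstC q) := by
  apply Complex.ext <;> simp [fstC, sndC] <;> ring

theorem complexify_one {n : ℕ} : complexify (1 : Matrix (Fin n) (Fin n) ℍ[ℝ]) = 1 := by
  have h1 : fstC 1 = 1 := by apply Complex.ext <;> simp [fstC]
  have h2 : sndC 1 = 0 := by apply Complex.ext <;> simp [sndC]
  have h3 : fstC 0 = 0 := by apply Complex.ext <;> simp [fstC]
  have h4 : sndC 0 = 0 := by apply Complex.ext <;> simp [sndC]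
  ext i j
  rcases i with i | i <;> rcases j with j | j <;>
    by_cases h : i = j <;> simp [complexify, Matrix.one_apply, h, h1, h2, h3, h4]

theorem complexify_add {n : ℕ} (A B : Matrix (Fin n) (Fin n) ℍ[ℝ]) :
    complexify (A + B) = complexify A + complexify B := by
  have h1 (p q : ℍ[ℝ]) : fstC (p + q) = fstC p + fstC q := rfl
  have h2 (p q : ℍ[ℝ]) : sndC (p + q) = sndC p + sndC q := rfl
  ext i j
  rcases i with i | i <;> rcases j with j | j <;> simp [complexify, h1, h2]
  ring

theorem complexify_mul {n : ℕ} (A B : Matrix (Fin n) (Fin n) ℍ[ℝ]) :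
    complexify (A * B) = complexify A * complexify B := by
  ext i j
  rcases i with i | i <;> rcases j with j | j <;>
    simp only [complexify, Matrix.mul_apply, Fintype.sum_sum_type, Matrix.fromBlocks_apply₁₁,
      Matrix.fromBlocks_apply₁₂, Matrix.fromBlocks_apply₂₁, Matrix.fromBlocks_apply₂₂,
      Matrix.map_apply, fstC_sum, sndC_sum, fstC_mul, sndC_mul, map_sum, map_add, map_sub,
      map_mul, Complex.conj_conj, ← Finset.sum_add_distrib, ← Finset.sum_neg_distrib] <;>
    exact Finset.sum_congr rfl fun _ _ => by ring

/-- The quaternionic determinant: the determinant of the associated complex matrix. -/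
def detH (n : ℕ) : Matrix (Fin n) (Fin n) ℍ[ℝ] →* ℂ where
  toFun A := (complexify A).det
  map_one' := by simp [complexify_one]
  map_mul' A B := by simp [complexify_mul]

/-- `SL(n, ℍ)`: the invertible quaternionic matrices of quaternionic determinant `1`. -/
def SL (n : ℕ) : Subgroup (Matrix (Fin n) (Fin n) ℍ[ℝ])ˣ :=
  ((detH n).comp (Units.coeHom _)).ker

/-- The underlying matrix of an element of `SL(n, ℍ)`. -/
def toMat {n : ℕ} (A : SL n) : Matrix (Fin n) (Fin n) ℍ[ℝ] := A.1.1

/-- `SL(n, ℍ)` acts on column vectors by matrix multiplication from the left. -/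
instance (n : ℕ) : DistribMulAction (SL n) (Fin n → ℍ[ℝ]) where
  smul A v := toMat A *ᵥ v
  one_smul v := Matrix.one_mulVec v
  mul_smul A B v := (Matrix.mulVec_mulVec v (toMat A) (toMat B)).symm
  smul_zero A := Matrix.mulVec_zero (toMat A)
  smul_add A v w := Matrix.mulVec_add (toMat A) v w

theorem smul_def {n : ℕ} (A : SL n) (v : Fin n → ℍ[ℝ]) : A • v = toMat A *ᵥ v := rfl

instance (n : ℕ) : SMulCommClass (SL n) (ℍ[ℝ])ᵐᵒᵖ (Fin n → ℍ[ℝ]) where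
  smul_comm A c v := Matrix.mulVec_smul (toMat A) c v

theorem smul_mk {n : ℕ} (A : SL n) (v : Fin n → ℍ[ℝ]) (hv : v ≠ 0) :
    A • (Projectivization.mk (ℍ[ℝ])ᵐᵒᵖ v hv : Space n) =
      Projectivization.mk (ℍ[ℝ])ᵐᵒᵖ (A • v) ((smul_ne_zero_iff_ne A).mpr hv) := rfl

/-- `PSL(n, ℍ)`: the quotient of `SL(n, ℍ)` by its centre. -/
abbrev PSL (n : ℕ) : Type := SL n ⧸ Subgroup.center (SL n)

/-- Unipotent elements `1 + N` with `N² = 0` lie in `SL(n, ℍ)`. -/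
theorem detH_one_add {n : ℕ} (N : Matrix (Fin n) (Fin n) ℍ[ℝ]) (hN : N * N = 0) :
    detH n (1 + N) = 1 := by
  have h0 : complexify (0 : Matrix (Fin n) (Fin n) ℍ[ℝ]) = 0 := by
    have := complexify_add (0 : Matrix (Fin n) (Fin n) ℍ[ℝ]) 0
    simpa using this
  have hnil : IsNilpotent (complexify N) :=
    ⟨2, by rw [pow_two, ← complexify_mul, hN, h0]⟩
  have h1 := (Matrix.isNilpotent_charpoly_sub_pow_of_isNilpotent hnil).eq_zero
  have h2 := congrArg (Polynomial.eval (-1)) (sub_eq_zero.mp h1)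
  rw [Matrix.eval_charpoly] at h2
  have h3 : Matrix.scalar (Fin n ⊕ Fin n) (-1 : ℂ) - complexify N
      = -(1 + complexify N) := by
    rw [map_neg, map_one]; abel
  rw [h3, Matrix.det_neg] at h2
  change (complexify (1 + N)).det = 1
  rw [complexify_add, complexify_one]
  simpa using h2

/-- The centre of `SL(n, ℍ)` acts trivially on projective space. -/
theorem center_smul {n : ℕ} (A : SL n) (hA : A ∈ Subgroup.center (SL n)) (x : Space n) :
    A • x = x := by
  induction x using Projectivization.ind with
  | h v hv =>
  rw [smul_mk, Projectivization.mk_eq_mk_iff']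
  obtain ⟨j, hj⟩ : ∃ j, v j ≠ 0 := by
    by_contra! h
    exact hv (funext h)
  by_cases hn : ∃ i : Fin n, i ≠ j
  · obtain ⟨i, hij⟩ := hn
    set f : Fin n → ℍ[ℝ] := Pi.single i 1 - Pi.single j (v i * (v j)⁻¹) with hf
    have hfv : f ⬝ᵥ v = 0 := by
      simp [hf, sub_dotProduct, hj]
    have hfi : f i = 1 := by simp [hf, hij]
    set N : Matrix (Fin n) (Fin n) ℍ[ℝ] := Matrix.vecMulVec v f with hNdef
    have hNN : N * N = 0 := by
      refine Matrix.ext fun a b => ?_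
      have : ∀ x, v a * f x * (v x * f b) = v a * (f x * v x) * f b := fun x => by noncomm_ring
      simp only [hNdef, Matrix.mul_apply, Matrix.vecMulVec_apply, this, Matrix.zero_apply]
      rw [← Finset.sum_mul, ← Finset.mul_sum]
      change v a * (f ⬝ᵥ v) * f b = 0
      simp [hfv]
    let T : SL n := ⟨⟨1 + N, 1 - N, by noncomm_ring; simp [hNN], by noncomm_ring; simp [hNN]⟩,
      detH_one_add N hNN⟩
    have hc : toMat A * (1 + N) = (1 + N) * toMat A :=
      congrArg toMat ((Subgroup.mem_center_iff.mp hA T).symm)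
    have hc' : toMat A * N = N * toMat A := by
      simpa [mul_add, add_mul] using hc
    have hNw : ∀ w, N *ᵥ w = MulOpposite.op (f ⬝ᵥ w) • v := by
      intro w
      ext1 a
      simp [hNdef, Matrix.mulVec, dotProduct, Matrix.vecMulVec_apply, Finset.mul_sum, mul_assoc]
    refine ⟨MulOpposite.op (f ⬝ᵥ (toMat A *ᵥ Pi.single i 1)), ?_⟩
    rw [← hNw, Matrix.mulVec_mulVec, ← hc', ← Matrix.mulVec_mulVec, hNw]
    simp [hfi, smul_def]
  · push Not at hn
    refine ⟨MulOpposite.op ((v j)⁻¹ * (A • v) j), ?_⟩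
    ext1 a
    rw [hn a]
    simp [hj]

/-- `PSL(n, ℍ)` acts on projective space through lifts to `SL(n, ℍ)`. -/
instance (n : ℕ) : MulAction (PSL n) (Space n) :=
  MulAction.compHom (Space n)
    (QuotientGroup.lift (Subgroup.center (SL n)) (MulAction.toPermHom (SL n) (Space n))
      fun A hA => Equiv.ext fun x => center_smul A hA x)

theorem mk_smul {n : ℕ} (A : SL n) (x : Space n) : (A : PSL n) • x = A • x := rfl

/-- The Jordan block `J(c, l)`: `c` on the diagonal, `1` on the superdiagonal. -/
def jordanBlock (c : ℍ[ℝ]) (l : ℕ) : Matrix (Fin l) (Fin l) ℍ[ℝ] :=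
  Matrix.of fun i j => if i = j then c else if (i : ℕ) + 1 = j then 1 else 0

/-- The block diagonal matrix `diag(D(d₁, …, d_k), J(1, l))` of size `k + l`. -/
def diagJordan {k : ℕ} (d : Fin k → ℍ[ℝ]) (l : ℕ) :
    Matrix (Fin (k + l)) (Fin (k + l)) ℍ[ℝ] :=
  Matrix.reindex finSumFinEquiv finSumFinEquiv
    (Matrix.fromBlocks (Matrix.diagonal d) 0 0 (jordanBlock 1 l))

end QuatProj

end

open Filter

namespace QuatProj

variable {n : ℕ}

/-! ### The topology of projective space -/

/-! Write `V` for the span of the first `k + 1` basis points and `H` for the claimed limit set. The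
`m`-th power of the matrix multiplies the diagonal coordinates by unit quaternions and acts on the
Jordan coordinates by the binomial coefficients `choose m (t - i)`, for `m` of either sign. If `v`
is not in `V` and `j > 0` is its last nonzero Jordan coordinate, dividing by `m ^ j` leaves in the
limit only a multiple of `e_{k+1}` (`tendsto_flow`). Hence orbits outside `V` are free and converge
to `e_{k+1}`, so `L0` and `L1` lie in `V`. On `V` the powers come from a compact group, so each
point is recurrent and `V ⊆ L0 ∪ L1`.

For `L2 ⊆ H`: near a point with nonzero last coordinate the inverse powers converge uniformly to
`e_{k+1}`, which is in `L0` and hence has a neighbourhood missing the compact set `K`; so only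
finitely many translates of `K` come near that point.

Conversely, if `l = 2` then `H = V`. If `l ≥ 3`, take `v` in `H` with nonzero penultimate coordinate
and add to its last coordinate a term of order `1/m` that makes the `e_{k+1}`-coordinate of the
`m`-th image vanish. These images then stay in a compact set off `V`
(`exists_isCompact_flow_corrected`), and pulling them back gives vectors tending to `v`, so `v` is
in `L2`. Such points are dense in `H`. -/

theorem continuous_mk' : Continuous
    (Projectivization.mk' (ℍ[ℝ])ᵐᵒᵖ : {v : Fin n → ℍ[ℝ] // v ≠ 0} → Space n) :=
  continuous_coinduced_rng

theorem mk_mem_of_mem_nhds {v : Fin n → ℍ[ℝ]} (hv : v ≠ 0) {U : Set (Space n)}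
    (hU : U ∈ 𝓝 (Projectivization.mk (ℍ[ℝ])ᵐᵒᵖ v hv : Space n)) :
    ∀ᶠ w in 𝓝 v, ∀ hw : w ≠ 0, (Projectivization.mk (ℍ[ℝ])ᵐᵒᵖ w hw : Space n) ∈ U := by
  have h := (continuous_mk' (n := n)).continuousAt (x := ⟨v, hv⟩) |>.preimage_mem_nhds hU
  obtain ⟨t, ht, hts⟩ := (mem_nhds_subtype {v | v ≠ 0} ⟨v, hv⟩ _).mp h
  filter_upwards [ht] with w hw h0
  exact hts (a := ⟨w, h0⟩) hw

theorem continuous_coord (i : Fin n) : Continuous fun x : {v : Fin n → ℍ[ℝ] // v ≠ 0} => x.1 i :=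
  (continuous_apply i).comp continuous_subtype_val

/-- The fibres are orbits of scalar multiplication, and each nonzero scalar acts continuously on
nonzero vectors. -/
theorem isOpenMap_mk' : IsOpenMap
    (Projectivization.mk' (ℍ[ℝ])ᵐᵒᵖ : {v : Fin n → ℍ[ℝ] // v ≠ 0} → Space n) := by
  intro s hs
  rw [isOpen_coinduced, isOpen_iff_mem_nhds]
  rintro ⟨w, hw⟩ ⟨⟨v, hv⟩, hvs, h⟩
  obtain ⟨c, hc⟩ := (Projectivization.mk_eq_mk_iff' _ _ _ hv hw).mp h
  have hc0 : c ≠ 0 := by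
    rintro rfl
    exact hv (by simpa using hc.symm)
  let f : {v : Fin n → ℍ[ℝ] // v ≠ 0} → {v : Fin n → ℍ[ℝ] // v ≠ 0} :=
    fun x => ⟨c • x.1, smul_ne_zero hc0 x.2⟩
  have hf : Continuous f := by
    refine Continuous.subtype_mk ?_ _
    refine continuous_pi fun i => ?_
    have : Continuous fun x : {v : Fin n → ℍ[ℝ] // v ≠ 0} => x.1 i * c.unop :=
      (continuous_coord i).mul continuous_const
    exact this
  have hfs : f ⁻¹' s ∈ 𝓝 (⟨w, hw⟩ : {v : Fin n → ℍ[ℝ] // v ≠ 0}) := by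
    refine (hs.preimage hf).mem_nhds ?_
    change f ⟨w, hw⟩ ∈ s
    convert hvs using 1
    exact Subtype.ext hc
  refine mem_of_superset hfs fun x hx => ⟨f x, hx, ?_⟩
  exact (Projectivization.mk_eq_mk_iff' _ _ _ _ _).mpr ⟨c, rfl⟩

theorem mk_mem_nhds {v : Fin n → ℍ[ℝ]} (hv : v ≠ 0) {P : (Fin n → ℍ[ℝ]) → Prop}
    (hP : ∀ᶠ w in 𝓝 v, P w) :
    {p : Space n | ∃ w, ∃ hw : w ≠ 0, P w ∧ p = Projectivization.mk (ℍ[ℝ])ᵐᵒᵖ w hw} ∈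
      𝓝 (Projectivization.mk (ℍ[ℝ])ᵐᵒᵖ v hv : Space n) := by
  have h : {x : {v : Fin n → ℍ[ℝ] // v ≠ 0} | P x.1} ∈ 𝓝 ⟨v, hv⟩ :=
    continuous_subtype_val.continuousAt.eventually hP
  refine mem_of_superset ((isOpenMap_mk' (n := n)).image_mem_nhds h) ?_
  rintro _ ⟨⟨w, hw⟩, hPw, rfl⟩
  exact ⟨w, hw, hPw, rfl⟩

/-- The entries of the orthogonal projection onto the line spanned by a vector. -/
noncomputable def projEntry (x : {v : Fin n → ℍ[ℝ] // v ≠ 0}) (i j : Fin n) : ℍ[ℝ] :=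
  (∑ a, Quaternion.normSq (x.1 a))⁻¹ • (x.1 i * star (x.1 j))

theorem sum_normSq_pos (x : {v : Fin n → ℍ[ℝ] // v ≠ 0}) :
    0 < ∑ a, Quaternion.normSq (x.1 a) := by
  obtain ⟨j, hj⟩ := Function.ne_iff.mp x.2
  refine Finset.sum_pos' (fun a _ => Quaternion.normSq_nonneg) ⟨j, Finset.mem_univ _, ?_⟩
  exact lt_of_le_of_ne Quaternion.normSq_nonneg fun h => hj (Quaternion.normSq_eq_zero.mp h.symm)

theorem continuous_projEntry :
    Continuous (projEntry : {v : Fin n → ℍ[ℝ] // v ≠ 0} → Fin n → Fin n → ℍ[ℝ]) := by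
  refine continuous_pi fun i => continuous_pi fun j => ?_
  refine Continuous.smul (Continuous.inv₀ ?_ fun x => (sum_normSq_pos x).ne') ?_
  · exact continuous_finsetSum _ fun a _ => Quaternion.continuous_normSq.comp (continuous_coord a)
  · exact (continuous_coord i).mul (continuous_coord j).star

/-- Scalars act on the right, so `c * star c` appears in the middle of the product; being real, it
is central and cancels against the normalisation. -/
theorem projEntry_smul {v : Fin n → ℍ[ℝ]} (c : (ℍ[ℝ])ᵐᵒᵖ) (hv : v ≠ 0) (hcv : c • v ≠ 0) :
    projEntry ⟨c • v, hcv⟩ = projEntry ⟨v, hv⟩ := by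
  have hc : Quaternion.normSq c.unop ≠ 0 := by
    rw [Ne, Quaternion.normSq_eq_zero]
    intro h
    exact hcv (by rw [(MulOpposite.unop_eq_zero_iff c).mp h, zero_smul])
  funext i j
  have h1 : (v i * c.unop) * star (v j * c.unop) =
      Quaternion.normSq c.unop • (v i * star (v j)) := by
    rw [star_mul, mul_assoc, ← mul_assoc c.unop, Quaternion.self_mul_star, ← mul_assoc,
      ← (Quaternion.coe_commutes _ (v i)), mul_assoc, Quaternion.coe_mul_eq_smul]
  simp only [projEntry, Pi.smul_apply, MulOpposite.smul_eq_mul_unop, map_mul, h1, smul_smul]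
  rw [← Finset.sum_mul, mul_inv, mul_assoc, inv_mul_cancel₀ hc, mul_one]

/-- The orthogonal projection onto a line depends continuously on the line and determines it, since
any nonzero column spans it. -/
instance : T2Space (Space n) := by
  let f : Space n → Fin n → Fin n → ℍ[ℝ] := Projectivization.lift projEntry (by
    rintro ⟨a, ha⟩ ⟨b, hb⟩ t (rfl : a = t • b)
    exact projEntry_smul t hb ha)
  refine T2Space.of_injective_continuous (f := f) ?_
    (continuous_coinduced_dom.mpr continuous_projEntry)
  intro p q h
  induction p using Projectivization.ind with
  | h v hv =>
  induction q using Projectivization.ind with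
  | h w hw =>
  change projEntry ⟨v, hv⟩ = projEntry ⟨w, hw⟩ at h
  obtain ⟨j, hj⟩ := Function.ne_iff.mp hv
  rw [Projectivization.mk_eq_mk_iff']
  have hs := sum_normSq_pos ⟨v, hv⟩
  set s := ∑ a, Quaternion.normSq (v a)
  set t := ∑ a, Quaternion.normSq (w a)
  have hj' : star (v j) ≠ 0 := star_ne_zero.mpr hj
  -- The scalar comes from solving the equality of the `j`-th columns of the two projections for
  -- `v`.
  refine ⟨MulOpposite.op ((s * t⁻¹) • (star (w j) * (star (v j))⁻¹)), ?_⟩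
  funext i
  have h1 : s⁻¹ • (v i * star (v j)) = t⁻¹ • (w i * star (w j)) := congrFun (congrFun h i) j
  rw [inv_smul_eq_iff₀ hs.ne', smul_smul] at h1
  simp only [Pi.smul_apply, MulOpposite.smul_eq_mul_unop, MulOpposite.unop_op]
  rw [mul_smul_comm, ← mul_assoc, ← smul_mul_assoc, ← h1, mul_assoc, mul_inv_cancel₀ hj', mul_one]

/-! ### Coordinate subspaces -/

/-- The vectors whose coordinates with index at least `r` vanish. -/
noncomputable def coordSubmodule (n r : ℕ) : Submodule (ℍ[ℝ])ᵐᵒᵖ (Fin n → ℍ[ℝ]) where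
  carrier := {v | ∀ i : Fin n, r ≤ i → v i = 0}
  add_mem' hv hw i hi := by simp [hv i hi, hw i hi]
  zero_mem' i _ := rfl
  smul_mem' c v hv i hi := by simp [hv i hi]

/-- The points of projective space whose coordinates with index at least `r` vanish. -/
noncomputable def coordSubspace (n r : ℕ) : Projectivization.Subspace (ℍ[ℝ])ᵐᵒᵖ (Fin n → ℍ[ℝ]) :=
  (coordSubmodule n r).projectivization

theorem mk_mem_coordSubspace {r : ℕ} {v : Fin n → ℍ[ℝ]} (hv : v ≠ 0) :
    (Projectivization.mk (ℍ[ℝ])ᵐᵒᵖ v hv : Space n) ∈ coordSubspace n r ↔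
      ∀ i : Fin n, r ≤ i → v i = 0 := Iff.rfl

theorem coordSubspace_mono {r s : ℕ} (h : r ≤ s) :
    (coordSubspace n r : Set (Space n)) ⊆ coordSubspace n s := by
  intro p hp
  induction p using Projectivization.ind with
  | h v hv => exact fun i hi => hp i (h.trans hi)

theorem isClosed_coordSubspace (r : ℕ) : IsClosed (coordSubspace n r : Set (Space n)) := by
  rw [isClosed_coinduced]
  have : (Projectivization.mk' (ℍ[ℝ])ᵐᵒᵖ : {v : Fin n → ℍ[ℝ] // v ≠ 0} → Space n) ⁻¹'
      (coordSubspace n r : Set (Space n)) = ⋂ i : Fin n, ⋂ _ : r ≤ i, {x | x.1 i = 0} := by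
    ext x
    rw [Set.mem_iInter₂]
    exact Iff.rfl
  rw [this]
  exact isClosed_iInter fun i => isClosed_iInter fun _ =>
    isClosed_eq (continuous_coord i) continuous_const

theorem span_stdPoint :
    Projectivization.Subspace.span
      {p : Space n | ∃ i : Fin n, (i : ℕ) + 1 < n ∧ p = stdPoint i} = coordSubspace n (n - 1) := by
  refine Projectivization.Subspace.span_eq_of_le ?_ ?_
  · rintro _ ⟨i, hi, rfl⟩ j hj
    have : j ≠ i := by rintro rfl; omega
    simp [this]
  · set T := Projectivization.Subspace.span
      {p : Space n | ∃ i : Fin n, (i : ℕ) + 1 < n ∧ p = stdPoint i}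
    intro p hp
    induction p using Projectivization.ind with
    | h v hv =>
    rw [← Projectivization.Subspace.mem_submodule_iff _ hv]
    have hsum : v = ∑ i, MulOpposite.op (v i) • (Pi.single i 1 : Fin n → ℍ[ℝ]) := by
      funext j
      simp [Finset.sum_apply, Pi.single_apply]
    rw [hsum]
    refine Submodule.sum_mem _ fun i _ => ?_
    by_cases hi : (i : ℕ) + 1 < n
    · refine Submodule.smul_mem _ _ ?_
      rw [Projectivization.Subspace.mem_submodule_iff _ (by simp)]
      exact Projectivization.Subspace.subset_span _ ⟨i, hi, rfl⟩
    · have hi0 : v i = 0 := hp i (by omega)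
      simp [hi0]

end QuatProj

/-! ### Growth of binomial coefficients -/

theorem Ring.choose_succ_eq (x : ℝ) (r : ℕ) :
    Ring.choose x (r + 1) = Ring.choose x r * ((x - r) / (r + 1)) := by
  rw [Ring.choose_eq_smul, Ring.choose_eq_smul, descPochhammer_succ_right,
    Polynomial.smeval_mul, Polynomial.smeval_sub, Polynomial.smeval_X, Polynomial.smeval_natCast,
    Nat.factorial_succ]
  simp only [smul_eq_mul, pow_one, pow_zero, nsmul_eq_mul, mul_one]
  push_cast
  rw [mul_inv]
  ring

/-- Each step of the recursion contributes a factor `(x - r) / (r + 1)`, asymptotic to `x / (r +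
1)`. The filter covers both signs of `x`, as negative powers are needed. -/
theorem tendsto_choose_div_pow_self (r : ℕ) :
    Tendsto (fun x : ℝ => Ring.choose x r / x ^ r) (Bornology.cobounded ℝ)
      (𝓝 ((r.factorial : ℝ)⁻¹)) := by
  induction r with
  | zero => simp
  | succ r ih =>
    have h1 : Tendsto (fun x : ℝ => (1 - r * x⁻¹) / (r + 1)) (Bornology.cobounded ℝ)
        (𝓝 ((1 - r * 0) / (r + 1))) :=
      (tendsto_const_nhds.sub (tendsto_inv₀_cobounded.const_mul _)).div_const _
    have h2 := ih.mul h1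
    have h3 : ((r.factorial : ℝ)⁻¹) * ((1 - r * 0) / (r + 1)) = (((r + 1).factorial : ℝ)⁻¹) := by
      rw [Nat.factorial_succ]
      push_cast
      rw [mul_inv]
      ring
    rw [h3] at h2
    refine h2.congr' ?_
    filter_upwards [Bornology.eventually_ne_cobounded (0 : ℝ)] with x hx
    rw [Ring.choose_succ_eq]
    field_simp
    ring

theorem tendsto_choose_div_pow {r s : ℕ} (h : r ≤ s) :
    Tendsto (fun x : ℝ => Ring.choose x r / x ^ s) (Bornology.cobounded ℝ)
      (𝓝 (if r = s then (s.factorial : ℝ)⁻¹ else 0)) := by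
  split_ifs with hrs
  · subst hrs
    exact tendsto_choose_div_pow_self r
  · have h1 := (tendsto_choose_div_pow_self r).mul
      ((tendsto_inv₀_cobounded (α := ℝ)).pow (s - r))
    rw [zero_pow (by omega), mul_zero] at h1
    refine h1.congr' ?_
    filter_upwards [Bornology.eventually_ne_cobounded (0 : ℝ)] with x hx
    have : x ^ s = x ^ r * x ^ (s - r) := by rw [← pow_add]; congr 1; omega
    rw [this, inv_pow]
    field_simp

theorem tendsto_intCast_cobounded :
    Tendsto (fun m : ℤ => (m : ℝ)) cofinite (Bornology.cobounded ℝ) := by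
  rw [Metric.cobounded_eq_cocompact]
  exact Int.tendsto_coe_cofinite

/-- The entry of index `(i, t)` of the power with exponent `x` of a unipotent Jordan block. -/
noncomputable def unipotentEntry (x : ℝ) (i t : ℕ) : ℝ :=
  if i ≤ t then Ring.choose x (t - i) else 0

/-- Pascal's rule, which is multiplication by the Jordan block read entrywise. -/
theorem unipotentEntry_add_one (x : ℝ) (i t : ℕ) :
    unipotentEntry (x + 1) i t = unipotentEntry x i t + unipotentEntry x (i + 1) t := by
  unfold unipotentEntry
  rcases lt_trichotomy i t with h | rfl | h
  · obtain ⟨r, rfl⟩ := Nat.exists_eq_add_of_lt h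
    rw [if_pos (by omega), if_pos (by omega), if_pos (by omega),
      show i + r + 1 - i = r + 1 by omega, show i + r + 1 - (i + 1) = r by omega,
      Ring.choose_succ_succ, add_comm]
  · simp
  · rw [if_neg (by omega), if_neg (by omega), if_neg (by omega), add_zero]

theorem unipotentEntry_zero (i t : ℕ) : unipotentEntry 0 i t = if i = t then 1 else 0 := by
  unfold unipotentEntry
  rcases lt_trichotomy i t with h | rfl | h
  · rw [if_pos h.le, if_neg h.ne, Ring.choose_zero_pos ℝ (by omega)]
  · simp
  · rw [if_neg (by omega), if_neg (by omega)]

theorem tendsto_unipotentEntry_div_pow {i t s : ℕ} (h : t ≤ s + i) :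
    Tendsto (fun x : ℝ => unipotentEntry x i t / x ^ s) (Bornology.cobounded ℝ)
      (𝓝 (if t = s + i then (s.factorial : ℝ)⁻¹ else 0)) := by
  unfold unipotentEntry
  by_cases hit : i ≤ t
  · simp only [if_pos hit]
    have h1 := tendsto_choose_div_pow (r := t - i) (s := s) (by omega)
    have h2 : (t - i = s) ↔ (t = s + i) := by omega
    simpa only [h2] using h1
  · simp only [if_neg hit, zero_div]
    rw [if_neg (by omega)]
    exact tendsto_const_nhds

namespace QuatProj

variable {k l : ℕ}

/-! ### Powers of the matrix `diag(D(d₁, …, d_k), J(1, l))` -/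

/-- The vector obtained from `v` by applying the `m`-th power of `diagJordan d l`. -/
noncomputable def flow (d : Fin k → ℍ[ℝ]) (m : ℤ) (v : Fin (k + l) → ℍ[ℝ]) : Fin (k + l) → ℍ[ℝ] :=
  Fin.addCases (fun i => d i ^ m * v (Fin.castAdd l i))
    (fun i => ∑ t : Fin l, unipotentEntry m i t • v (Fin.natAdd k t))

@[simp]
theorem flow_castAdd (d : Fin k → ℍ[ℝ]) (m : ℤ) (v : Fin (k + l) → ℍ[ℝ]) (i : Fin k) :
    flow d m v (Fin.castAdd l i) = d i ^ m * v (Fin.castAdd l i) := by simp [flow]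

@[simp]
theorem flow_natAdd (d : Fin k → ℍ[ℝ]) (m : ℤ) (v : Fin (k + l) → ℍ[ℝ]) (i : Fin l) :
    flow d m v (Fin.natAdd k i) = ∑ t : Fin l, unipotentEntry m i t • v (Fin.natAdd k t) := by
  simp [flow]

theorem flow_zero (d : Fin k → ℍ[ℝ]) (v : Fin (k + l) → ℍ[ℝ]) : flow d 0 v = v := by
  funext i
  refine Fin.addCases (fun i => by simp) (fun i => ?_) i
  simp [unipotentEntry_zero, ← Fin.ext_iff]

/-- Letting `g` live on `ℕ` with `g l = 0` treats the last row like the others. -/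
theorem sum_jordanBlock_mul (g : ℕ → ℍ[ℝ]) (hg : g l = 0) (i : Fin l) :
    ∑ j : Fin l, jordanBlock 1 l i j * g j = g i + g (i + 1) := by
  have h : ∀ j : Fin l, jordanBlock 1 l i j * g j =
      (if (i : ℕ) = j then g j else 0) + (if (i : ℕ) + 1 = j then g j else 0) := by
    intro j
    simp only [jordanBlock, Matrix.of_apply, Fin.ext_iff]
    split_ifs with h1 h2
    · omega
    all_goals simp
  simp only [h]
  rw [Finset.sum_add_distrib,
    Fin.sum_univ_eq_sum_range (fun j => if (i : ℕ) = j then g j else 0),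
    Fin.sum_univ_eq_sum_range (fun j => if (i : ℕ) + 1 = j then g j else 0)]
  simp only [Finset.sum_ite_eq, Finset.mem_range, i.2, if_true]
  split_ifs with h1
  · rfl
  · rw [show (i : ℕ) + 1 = l by omega, hg]

theorem diagJordan_mulVec_flow {d : Fin k → ℍ[ℝ]} (hd : ∀ i, d i ≠ 0) (m : ℤ)
    (v : Fin (k + l) → ℍ[ℝ]) : diagJordan d l *ᵥ flow d m v = flow d (m + 1) v := by
  funext i
  refine Fin.addCases (fun i => ?_) (fun i => ?_) i
  · simp [diagJordan, Matrix.mulVec, dotProduct, Fin.sum_univ_add, Matrix.diagonal_apply,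
      zpow_add_one₀ (hd i), ← mul_assoc, ((Commute.refl (d i)).zpow_right₀ m).eq]
  · have h := sum_jordanBlock_mul
      (fun j => ∑ t : Fin l, unipotentEntry m j t • v (Fin.natAdd k t)) (by
        refine Finset.sum_eq_zero fun t _ => ?_
        rw [unipotentEntry, if_neg (by omega), zero_smul]) i
    simp only [diagJordan, Matrix.mulVec, dotProduct, Fin.sum_univ_add, flow_natAdd]
    simp only [Matrix.reindex_apply, Matrix.submatrix_apply, finSumFinEquiv_symm_apply_natAdd,
      finSumFinEquiv_symm_apply_castAdd, Matrix.fromBlocks_apply₂₁, Matrix.fromBlocks_apply₂₂,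
      Matrix.zero_apply, zero_mul, Finset.sum_const_zero, zero_add, h]
    rw [← Finset.sum_add_distrib]
    refine Finset.sum_congr rfl fun t _ => ?_
    rw [← add_smul, Int.cast_add, Int.cast_one, unipotentEntry_add_one]

theorem zpow_smul_eq_flow {d : Fin k → ℍ[ℝ]} (hd : ∀ i, d i ≠ 0) {γ : SL (k + l)}
    (hγ : toMat γ = diagJordan d l) (m : ℤ) (v : Fin (k + l) → ℍ[ℝ]) :
    γ ^ m • v = flow d m v := by
  have hstep : ∀ m : ℤ, γ • flow d m v = flow d (m + 1) v := fun m => by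
    rw [smul_def, hγ, diagJordan_mulVec_flow hd]
  have hadd : ∀ m : ℤ, γ ^ (m + 1) • v = γ • γ ^ m • v := fun m => by
    rw [zpow_add_one, (Commute.refl γ).zpow_left m |>.eq]
    exact mul_smul γ (γ ^ m) v
  induction m with
  | zero =>
    rw [flow_zero, zpow_zero]
    exact one_smul _ v
  | succ m ih => rw [hadd, ih, hstep]
  | pred m ih =>
    -- Going down, the recursion is inverted by cancelling `γ`.
    have h1 := hstep (-m - 1)
    have h2 := hadd (-m - 1)
    rw [sub_add_cancel] at h1 h2
    exact smul_left_cancel γ (h2.symm.trans (ih.trans h1.symm))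

end QuatProj

namespace QuatProj

variable {k l : ℕ}

/-! ### Dynamics of the powers on vectors -/

theorem norm_zpow_mul {a : ℍ[ℝ]} (ha : ‖a‖ = 1) (m : ℤ) (b : ℍ[ℝ]) : ‖a ^ m * b‖ = ‖b‖ := by
  rw [norm_mul, norm_zpow, ha, one_zpow, one_mul]

theorem ne_zero_of_norm_one {d : Fin k → ℍ[ℝ]} (hd : ∀ i, ‖d i‖ = 1) (i : Fin k) : d i ≠ 0 :=
  norm_ne_zero_iff.mp (by rw [hd i]; exact one_ne_zero)

/-- Entry `(a, t)` has degree `t - a` in `m`, so among the entries that matter only `(0, j)` reaches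
degree `j`; the diagonal coordinates are bounded and die because `j > 0`. The vector varies along
`F` so that the same statement gives convergence locally uniform in the starting point. -/
theorem tendsto_flow {ι : Type*} {F : Filter ι} {d : Fin k → ℍ[ℝ]} (hd : ∀ i, ‖d i‖ = 1)
    {m : ι → ℤ} (hm : Tendsto m F cofinite) {v : ι → Fin (k + l) → ℍ[ℝ]} {y : Fin (k + l) → ℍ[ℝ]}
    (hv : Tendsto v F (𝓝 y)) (hl : 0 < l) {j : Fin l} (hj : 0 < (j : ℕ))
    (h0 : ∀ i, ∀ t : Fin l, j < t → v i (Fin.natAdd k t) = 0) :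
    Tendsto (fun i => ((m i : ℝ) ^ (j : ℕ))⁻¹ • flow d (m i) (v i)) F
      (𝓝 (Pi.single (Fin.natAdd k ⟨0, hl⟩) (((j : ℕ).factorial : ℝ)⁻¹ • y (Fin.natAdd k j)))) := by
  have hmc : Tendsto (fun i => (m i : ℝ)) F (Bornology.cobounded ℝ) :=
    tendsto_intCast_cobounded.comp hm
  have hvi := tendsto_pi_nhds.mp hv
  rw [tendsto_pi_nhds]
  refine Fin.addCases (fun a => ?_) (fun a => ?_)
  · rw [Pi.single_eq_of_ne (by simp [Fin.ext_iff]; omega)]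
    have h1 := ((tendsto_inv₀_cobounded.comp hmc).pow (j : ℕ)).norm.mul
      (hvi (Fin.castAdd l a)).norm
    rw [zero_pow hj.ne', norm_zero, zero_mul] at h1
    refine tendsto_zero_iff_norm_tendsto_zero.mpr (h1.congr fun i => ?_)
    rw [Pi.smul_apply, flow_castAdd, norm_smul, norm_zpow_mul (hd a), ← inv_pow]
    rfl
  · have hterm : ∀ t : Fin l, Tendsto
        (fun i => (unipotentEntry (m i) a t / (m i : ℝ) ^ (j : ℕ)) • v i (Fin.natAdd k t)) F
        (𝓝 (if t = j then (if (a : ℕ) = 0 then ((j : ℕ).factorial : ℝ)⁻¹ • y (Fin.natAdd k j)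
          else 0) else 0)) := by
      intro t
      by_cases htj : j < t
      · rw [if_neg htj.ne']
        simp only [h0 _ t htj, smul_zero]
        exact tendsto_const_nhds
      · have h1 : (t : ℕ) ≤ j := by simpa using htj
        have h2 := ((tendsto_unipotentEntry_div_pow (i := a) (t := t) (s := j)
          (by omega)).comp hmc).smul (hvi (Fin.natAdd k t))
        refine h2.trans_eq (congrArg 𝓝 ?_)
        by_cases h3 : t = j
        · subst h3
          by_cases h4 : (a : ℕ) = 0 <;> simp [h4]
        · rw [if_neg h3, if_neg (by rw [Fin.ext_iff] at h3; omega), zero_smul]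
    have hsum := tendsto_finsetSum Finset.univ fun t _ => hterm t
    rw [Finset.sum_ite_eq' Finset.univ j, if_pos (Finset.mem_univ j)] at hsum
    have hlim : (Pi.single (Fin.natAdd k ⟨0, hl⟩)
        (((j : ℕ).factorial : ℝ)⁻¹ • y (Fin.natAdd k j)) : Fin (k + l) → ℍ[ℝ]) (Fin.natAdd k a) =
        if (a : ℕ) = 0 then ((j : ℕ).factorial : ℝ)⁻¹ • y (Fin.natAdd k j) else 0 := by
      simp [Pi.single_apply, Fin.ext_iff]
    rw [hlim]
    refine hsum.congr fun i => ?_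
    rw [Pi.smul_apply, flow_natAdd, Finset.smul_sum]
    refine Finset.sum_congr rfl fun t _ => ?_
    rw [smul_smul, div_eq_inv_mul]

theorem real_smul_eq_op_smul {n : ℕ} (r : ℝ) (v : Fin n → ℍ[ℝ]) :
    r • v = MulOpposite.op (r : ℍ[ℝ]) • v := by
  funext i
  simp [Quaternion.mul_coe_eq_smul]

theorem mk_real_smul {n : ℕ} {r : ℝ} {v : Fin n → ℍ[ℝ]} (hv : v ≠ 0) (hrv : r • v ≠ 0) :
    (Projectivization.mk (ℍ[ℝ])ᵐᵒᵖ (r • v) hrv : Space n) = Projectivization.mk (ℍ[ℝ])ᵐᵒᵖ v hv :=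
  (Projectivization.mk_eq_mk_iff' _ _ _ _ _).mpr ⟨MulOpposite.op (r : ℍ[ℝ]),
    (real_smul_eq_op_smul r v).symm⟩

theorem mk_single {n : ℕ} (i : Fin n) {c : ℍ[ℝ]} (h : (Pi.single i c : Fin n → ℍ[ℝ]) ≠ 0) :
    (Projectivization.mk (ℍ[ℝ])ᵐᵒᵖ (Pi.single i c) h : Space n) = stdPoint i := by
  refine (Projectivization.mk_eq_mk_iff' _ _ _ _ _).mpr ⟨MulOpposite.op c, ?_⟩
  funext j
  by_cases hj : j = i
  · subst hj; simp
  · simp [hj]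

theorem eventually_mk_flow_mem {ι : Type*} {F : Filter ι} {d : Fin k → ℍ[ℝ]} (hd : ∀ i, ‖d i‖ = 1)
    {m : ι → ℤ} (hm : Tendsto m F cofinite) {v : ι → Fin (k + l) → ℍ[ℝ]} {y : Fin (k + l) → ℍ[ℝ]}
    (hv : Tendsto v F (𝓝 y)) (hl : 0 < l) {j : Fin l} (hj : 0 < (j : ℕ))
    (hy : y (Fin.natAdd k j) ≠ 0) (h0 : ∀ i, ∀ t : Fin l, j < t → v i (Fin.natAdd k t) = 0)
    {W : Set (Space (k + l))} (hW : W ∈ 𝓝 (stdPoint (Fin.natAdd k ⟨0, hl⟩))) :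
    ∀ᶠ i in F, ∀ h : flow d (m i) (v i) ≠ 0,
      (Projectivization.mk (ℍ[ℝ])ᵐᵒᵖ (flow d (m i) (v i)) h : Space (k + l)) ∈ W := by
  have hne : (Pi.single (Fin.natAdd k ⟨0, hl⟩)
      (((j : ℕ).factorial : ℝ)⁻¹ • y (Fin.natAdd k j)) : Fin (k + l) → ℍ[ℝ]) ≠ 0 := by
    rw [Ne, Pi.single_eq_zero_iff]
    exact smul_ne_zero (by positivity) hy
  rw [← mk_single _ hne] at hW
  have hm0 : ∀ᶠ i in F, m i ≠ 0 := hm.eventually (eventually_cofinite_ne 0)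
  filter_upwards [(tendsto_flow hd hm hv hl hj h0).eventually (mk_mem_of_mem_nhds hne hW), hm0]
    with i hi hmi h
  have hs : ((m i : ℝ) ^ (j : ℕ))⁻¹ • flow d (m i) (v i) ≠ 0 :=
    smul_ne_zero (inv_ne_zero (pow_ne_zero _ (Int.cast_ne_zero.mpr hmi))) h
  rw [← mk_real_smul h hs]
  exact hi hs

theorem flow_natAdd_eq_zero {d : Fin k → ℍ[ℝ]} {v : Fin (k + l) → ℍ[ℝ]} {j : Fin l}
    (h0 : ∀ t : Fin l, j ≤ t → v (Fin.natAdd k t) = 0) (m : ℤ) :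
    flow d m v (Fin.natAdd k j) = 0 := by
  rw [flow_natAdd]
  refine Finset.sum_eq_zero fun t _ => ?_
  by_cases h : j ≤ t
  · rw [h0 t h, smul_zero]
  · rw [unipotentEntry, if_neg (by simpa using h), zero_smul]

theorem flow_natAdd_top {d : Fin k → ℍ[ℝ]} {v : Fin (k + l) → ℍ[ℝ]} {j : Fin l}
    (h0 : ∀ t : Fin l, j < t → v (Fin.natAdd k t) = 0) (m : ℤ) :
    flow d m v (Fin.natAdd k j) = v (Fin.natAdd k j) := by
  rw [flow_natAdd, Finset.sum_eq_single j]
  · simp [unipotentEntry]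
  · intro t _ htj
    rcases lt_or_gt_of_ne htj with h | h
    · rw [unipotentEntry, if_neg (by simpa using h), zero_smul]
    · rw [h0 t h, smul_zero]
  · simp

theorem flow_natAdd_pred_top {d : Fin k → ℍ[ℝ]} {v : Fin (k + l) → ℍ[ℝ]} {i j : Fin l}
    (hij : (j : ℕ) = i + 1) (h0 : ∀ t : Fin l, j < t → v (Fin.natAdd k t) = 0) (m : ℤ) :
    flow d m v (Fin.natAdd k i) = v (Fin.natAdd k i) + (m : ℝ) • v (Fin.natAdd k j) := by
  rw [flow_natAdd, Finset.sum_eq_add i j (by simp [Fin.ext_iff]; omega)]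
  · simp [unipotentEntry, hij]
  · rintro t - ⟨h1, h2⟩
    rcases lt_or_gt_of_ne h1 with h | h
    · rw [unipotentEntry, if_neg (by simpa using h), zero_smul]
    · rw [h0 t (by rw [Fin.lt_def] at *; rw [Ne, Fin.ext_iff] at h2; omega), smul_zero]
  · simp
  · simp

/-- The top coordinate is unchanged, which forces `c = 1`; the one before it moves by `m` times the
top coordinate, which forces `m = 0`. -/
theorem eq_zero_of_flow_eq_smul {d : Fin k → ℍ[ℝ]} {v : Fin (k + l) → ℍ[ℝ]} {j : Fin l}
    (hj : 0 < (j : ℕ)) (hvj : v (Fin.natAdd k j) ≠ 0)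
    (h0 : ∀ t : Fin l, j < t → v (Fin.natAdd k t) = 0) {m : ℤ} {c : (ℍ[ℝ])ᵐᵒᵖ}
    (h : flow d m v = c • v) : m = 0 := by
  have h1 := congrFun h (Fin.natAdd k j)
  rw [flow_natAdd_top h0, Pi.smul_apply, MulOpposite.smul_eq_mul_unop] at h1
  have hc : c.unop = 1 := mul_left_cancel₀ hvj (by rw [← h1, mul_one])
  have h2 := congrFun h (Fin.natAdd k ⟨j - 1, by omega⟩)
  rw [flow_natAdd_pred_top (j := j) (by simp; omega) h0, Pi.smul_apply,
    MulOpposite.smul_eq_mul_unop, hc, mul_one, add_eq_left, smul_eq_zero] at h2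
  exact_mod_cast h2.resolve_right hvj

theorem exists_top_of_notMem {v : Fin (k + l) → ℍ[ℝ]} (hv : v ≠ 0)
    (h : (Projectivization.mk (ℍ[ℝ])ᵐᵒᵖ v hv : Space (k + l)) ∉ coordSubspace (k + l) (k + 1)) :
    ∃ j : Fin l, 0 < (j : ℕ) ∧ v (Fin.natAdd k j) ≠ 0 ∧
      ∀ t : Fin l, j < t → v (Fin.natAdd k t) = 0 := by
  classical
  rw [mk_mem_coordSubspace] at h
  push Not at h
  obtain ⟨i, hi, hvi⟩ := h
  obtain ⟨a, rfl⟩ : ∃ a : Fin l, i = Fin.natAdd k a :=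
    ⟨⟨i - k, by omega⟩, Fin.ext (by simp; omega)⟩
  have hne : (Finset.univ.filter fun t : Fin l => v (Fin.natAdd k t) ≠ 0).Nonempty :=
    ⟨a, by simpa using hvi⟩
  refine ⟨Finset.max' _ hne, ?_, ?_, fun t ht => ?_⟩
  · have h1 : a ≤ Finset.max' _ hne := Finset.le_max' _ _ (by simpa using hvi)
    rw [Fin.le_def] at h1
    simp only [Fin.val_natAdd] at hi
    omega
  · exact (Finset.mem_filter.mp (Finset.max'_mem _ hne)).2
  · by_contra h2
    exact absurd (Finset.le_max' _ t (by simpa using h2)) (not_le.mpr ht)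

/-! ### The cyclic group -/

/-- The elements of the cyclic group generated by the class of `γ`. -/
noncomputable def zpowElem {n : ℕ} (γ : SL n) (m : ℤ) : Subgroup.zpowers (γ : PSL n) :=
  ⟨(γ : PSL n) ^ m, m, rfl⟩

theorem zpowElem_smul {n : ℕ} (γ : SL n) (m : ℤ) (p : Space n) : zpowElem γ m • p = γ ^ m • p := by
  change (γ : PSL n) ^ m • p = _
  rw [← QuotientGroup.mk_zpow, mk_smul]

theorem zpowElem_neg_smul {n : ℕ} (γ : SL n) (m : ℤ) {p q : Space n} (h : zpowElem γ m • p = q) :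
    zpowElem γ (-m) • q = p := by
  have : zpowElem γ (-m) = (zpowElem γ m)⁻¹ := Subtype.ext (zpow_neg _ _)
  rw [this, ← h, inv_smul_smul]

theorem zpowElem_surjective {n : ℕ} (γ : SL n) : Function.Surjective (zpowElem γ) := by
  rintro ⟨_, m, rfl⟩
  exact ⟨m, rfl⟩

theorem zpowElem_smul_mk {d : Fin k → ℍ[ℝ]} (hd : ∀ i, ‖d i‖ = 1) {γ : SL (k + l)}
    (hγ : toMat γ = diagJordan d l) (m : ℤ) {v : Fin (k + l) → ℍ[ℝ]} (hv : v ≠ 0) :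
    ∃ h : flow d m v ≠ 0, zpowElem γ m • (Projectivization.mk (ℍ[ℝ])ᵐᵒᵖ v hv : Space (k + l)) =
      Projectivization.mk (ℍ[ℝ])ᵐᵒᵖ (flow d m v) h := by
  have h := (smul_ne_zero_iff_ne (γ ^ m)).mpr hv
  rw [zpowElem_smul, smul_mk]
  simp only [zpow_smul_eq_flow (ne_zero_of_norm_one hd) hγ] at h ⊢
  exact ⟨h, trivial⟩

theorem eq_zero_of_zpowElem_smul_eq {d : Fin k → ℍ[ℝ]} (hd : ∀ i, ‖d i‖ = 1) {γ : SL (k + l)}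
    (hγ : toMat γ = diagJordan d l) {m : ℤ} {p : Space (k + l)}
    (hp : p ∉ coordSubspace (k + l) (k + 1)) (h : zpowElem γ m • p = p) : m = 0 := by
  induction p using Projectivization.ind with
  | h v hv =>
  obtain ⟨j, hj, hvj, h0⟩ := exists_top_of_notMem hv hp
  obtain ⟨hf, hmk⟩ := zpowElem_smul_mk hd hγ m hv
  rw [hmk, Projectivization.mk_eq_mk_iff'] at h
  obtain ⟨c, hc⟩ := h
  exact eq_zero_of_flow_eq_smul hj hvj h0 hc.symm

theorem stdPoint_notMem {n r : ℕ} {i : Fin n} (h : r ≤ i) :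
    (stdPoint i : Space n) ∉ coordSubspace n r := by
  intro h1
  have : (Pi.single i 1 : Fin n → ℍ[ℝ]) i = 0 := h1 i h
  simp at this

theorem stdPoint_mem {n r : ℕ} {i : Fin n} (h : (i : ℕ) < r) :
    (stdPoint i : Space n) ∈ coordSubspace n r := by
  intro j hj
  have : j ≠ i := by rintro rfl; omega
  simp [this]

theorem zpowElem_injective (hl : 2 ≤ l) {d : Fin k → ℍ[ℝ]} (hd : ∀ i, ‖d i‖ = 1) {γ : SL (k + l)}
    (hγ : toMat γ = diagJordan d l) : Function.Injective (zpowElem γ) := by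
  intro a b hab
  have hp : (stdPoint (Fin.natAdd k ⟨1, hl⟩) : Space (k + l)) ∉ coordSubspace (k + l) (k + 1) :=
    stdPoint_notMem (by simp)
  have h1 : (γ : PSL (k + l)) ^ a = (γ : PSL (k + l)) ^ b := congrArg Subtype.val hab
  have h2 : zpowElem γ (a - b) = 1 := Subtype.ext (by
    change (γ : PSL (k + l)) ^ (a - b) = 1
    rw [zpow_sub, h1, mul_inv_cancel])
  have := eq_zero_of_zpowElem_smul_eq hd hγ hp (m := a - b) (by rw [h2, one_smul])
  omega

/-- The class of `γ` has infinite order, so infinitely many group elements means infinitely many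
exponents. -/
theorem isClusterPoint_iff (hl : 2 ≤ l) {d : Fin k → ℍ[ℝ]} (hd : ∀ i, ‖d i‖ = 1) {γ : SL (k + l)}
    (hγ : toMat γ = diagJordan d l)
    {A : Subgroup.zpowers (γ : PSL (k + l)) → Set (Space (k + l))} {p : Space (k + l)} :
    Kulkarni.IsClusterPoint A p ↔
      ∀ U ∈ 𝓝 p, ∃ᶠ m : ℤ in cofinite, (U ∩ A (zpowElem γ m)).Nonempty := by
  refine forall₂_congr fun U _ => ?_
  rw [frequently_cofinite_iff_infinite]
  have h := Set.image_preimage_eq {β | (U ∩ A β).Nonempty} (zpowElem_surjective γ)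
  conv_lhs => rw [← h]
  exact Set.infinite_image_iff (zpowElem_injective hl hd hγ).injOn

/-! ### Upper bounds for the limit set -/

theorem L0_subset (d : Fin k → ℍ[ℝ]) (hd : ∀ i, ‖d i‖ = 1) {γ : SL (k + l)}
    (hγ : toMat γ = diagJordan d l) :
    Kulkarni.L0 (Subgroup.zpowers (γ : PSL (k + l))) (Space (k + l)) ⊆
      coordSubspace (k + l) (k + 1) := by
  refine closure_minimal (fun p (hp : Infinite _) => ?_) (isClosed_coordSubspace _)
  by_contra hpV
  obtain ⟨⟨g, hg⟩, hg1⟩ := exists_ne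
    (1 : MulAction.stabilizer (Subgroup.zpowers (γ : PSL (k + l))) p)
  obtain ⟨m, rfl⟩ := zpowElem_surjective γ g
  obtain rfl := eq_zero_of_zpowElem_smul_eq hd hγ hpV hg
  exact hg1 (Subtype.ext (Subtype.ext (zpow_zero _)))

theorem zpowElem_smul_mem {d : Fin k → ℍ[ℝ]} (hd : ∀ i, ‖d i‖ = 1) {γ : SL (k + l)}
    (hγ : toMat γ = diagJordan d l) {p : Space (k + l)} (hp : p ∈ coordSubspace (k + l) (k + 1))
    (m : ℤ) : zpowElem γ m • p ∈ coordSubspace (k + l) (k + 1) := by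
  induction p using Projectivization.ind with
  | h v hv =>
  obtain ⟨hf, hmk⟩ := zpowElem_smul_mk hd hγ m hv
  rw [hmk, mk_mem_coordSubspace]
  intro i hi
  obtain ⟨a, rfl⟩ : ∃ a : Fin l, i = Fin.natAdd k a :=
    ⟨⟨i - k, by omega⟩, Fin.ext (by simp; omega)⟩
  refine flow_natAdd_eq_zero (fun t ht => hp _ ?_) m
  rw [Fin.le_def] at ht
  simp only [Fin.val_natAdd] at hi ⊢
  omega

/-- An orbit starting in the closed invariant subspace stays there; any other converges to
`e_{k+1}`, which by the Hausdorff property is its only cluster point. -/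
theorem L1_subset (hl : 2 ≤ l) {d : Fin k → ℍ[ℝ]} (hd : ∀ i, ‖d i‖ = 1) {γ : SL (k + l)}
    (hγ : toMat γ = diagJordan d l) :
    Kulkarni.L1 (Subgroup.zpowers (γ : PSL (k + l))) (Space (k + l)) ⊆
      coordSubspace (k + l) (k + 1) := by
  refine closure_minimal ?_ (isClosed_coordSubspace _)
  rintro p ⟨x, -, hcl⟩
  rw [isClusterPoint_iff hl hd hγ] at hcl
  by_contra hpV
  by_cases hx : x ∈ coordSubspace (k + l) (k + 1)
  · obtain ⟨m, q, hq, hqm⟩ := (hcl _ ((isClosed_coordSubspace _).isOpen_compl.mem_nhds hpV)).exists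
    rw [Set.mem_singleton_iff] at hqm
    subst hqm
    exact hq (zpowElem_smul_mem hd hγ hx m)
  · have hpe : p ≠ stdPoint (Fin.natAdd k ⟨0, by omega⟩) := by
      rintro rfl
      exact hpV (stdPoint_mem (by simp))
    obtain ⟨U, W, hU, hW, hpU, heW, hUW⟩ := t2_separation hpe
    induction x using Projectivization.ind with
    | h v hv =>
    obtain ⟨j, hj, hvj, h0⟩ := exists_top_of_notMem hv hx
    have hev := eventually_mk_flow_mem hd tendsto_id (tendsto_const_nhds (x := v)) (by omega)
      hj hvj (fun _ => h0) (hW.mem_nhds heW)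
    obtain ⟨m, ⟨q, hqU, hqm⟩, hm⟩ := ((hcl U (hU.mem_nhds hpU)).and_eventually hev).exists
    rw [Set.mem_singleton_iff] at hqm
    obtain ⟨hf, hmk⟩ := zpowElem_smul_mk hd hγ m hv
    rw [hqm, hmk] at hqU
    exact Set.disjoint_left.mp hUW hqU (hm hf)

theorem stdPoint_mem_L0 (hl : 2 ≤ l) {d : Fin k → ℍ[ℝ]} (hd : ∀ i, ‖d i‖ = 1) {γ : SL (k + l)}
    (hγ : toMat γ = diagJordan d l) : stdPoint (Fin.natAdd k ⟨0, by omega⟩) ∈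
      Kulkarni.L0 (Subgroup.zpowers (γ : PSL (k + l))) (Space (k + l)) := by
  refine subset_closure ?_
  have hfix : ∀ m : ℤ, zpowElem γ m • (stdPoint (Fin.natAdd k ⟨0, by omega⟩) : Space (k + l)) =
      stdPoint (Fin.natAdd k ⟨0, by omega⟩) := by
    intro m
    obtain ⟨hf, hmk⟩ := zpowElem_smul_mk hd hγ m
      (v := Pi.single (Fin.natAdd k ⟨0, by omega⟩) 1) (by simp)
    refine hmk.trans ((Projectivization.mk_eq_mk_iff' _ _ _ _ _).mpr ⟨1, ?_⟩)
    rw [one_smul]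
    funext i
    refine Fin.addCases (fun i => ?_) (fun i => ?_) i
    · rw [flow_castAdd, Pi.single_eq_of_ne (by simp [Fin.ext_iff]; omega), mul_zero]
    · rw [flow_natAdd, Finset.sum_eq_single ⟨0, by omega⟩]
      · by_cases hi : (i : ℕ) = 0
        · obtain rfl : i = ⟨0, Nat.zero_lt_of_lt hl⟩ := Fin.ext hi
          simp [unipotentEntry]
        · rw [unipotentEntry, if_neg (by simpa using hi), zero_smul,
            Pi.single_eq_of_ne (by simpa [Fin.ext_iff] using hi)]
      · intro t _ ht
        rw [Pi.single_eq_of_ne (by simpa [Fin.ext_iff] using ht), smul_zero]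
      · simp
  exact Infinite.of_injective (fun m : ℤ => (⟨zpowElem γ m, hfix m⟩ : MulAction.stabilizer
    (Subgroup.zpowers (γ : PSL (k + l))) (stdPoint (Fin.natAdd k ⟨0, by omega⟩) : Space (k + l))))
    fun a b hab => zpowElem_injective hl hd hγ (congrArg Subtype.val hab)

theorem L2_subset (hl : 2 ≤ l) {d : Fin k → ℍ[ℝ]} (hd : ∀ i, ‖d i‖ = 1) {γ : SL (k + l)}
    (hγ : toMat γ = diagJordan d l) :
    Kulkarni.L2 (Subgroup.zpowers (γ : PSL (k + l))) (Space (k + l)) ⊆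
      coordSubspace (k + l) (k + l - 1) := by
  refine closure_minimal ?_ (isClosed_coordSubspace _)
  rintro p ⟨K, hK, hKs, hcl⟩
  rw [isClusterPoint_iff hl hd hγ] at hcl
  by_contra hpH
  induction p using Projectivization.ind with
  | h v hv =>
  rw [SetLike.mem_coe, mk_mem_coordSubspace] at hpH
  push Not at hpH
  obtain ⟨i, hi, hvi⟩ := hpH
  have hie : i = Fin.natAdd k ⟨l - 1, by omega⟩ := Fin.ext (by simp; omega)
  rw [hie] at hvi
  have heK : Kᶜ ∈ 𝓝 (stdPoint (Fin.natAdd k ⟨0, by omega⟩) : Space (k + l)) :=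
    hK.isClosed.isOpen_compl.mem_nhds fun h => hKs h (Or.inl (stdPoint_mem_L0 hl hd hγ))
  -- The product filter lets exponent and vector vary together: all vectors near `v` are sent into
  -- the complement of `K` by all but finitely many inverse powers.
  have hev := eventually_mk_flow_mem hd (F := (cofinite : Filter ℤ) ×ˢ 𝓝 v) (m := fun x => -x.1)
    ((neg_injective.tendsto_cofinite).comp tendsto_fst) tendsto_snd (by omega)
    (j := ⟨l - 1, by omega⟩) (by simp; omega) hvi
    (fun _ t ht => by rw [Fin.lt_def] at ht; simp at ht; omega) heK
  obtain ⟨A, hA, P, hP, hAP⟩ := eventually_prod_iff.mp hev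
  obtain ⟨m, ⟨q, ⟨w, hw, hPw, rfl⟩, x, hxK, hx⟩, hm⟩ :=
    ((hcl _ (mk_mem_nhds hv hP)).and_eventually hA).exists
  have h1 := zpowElem_neg_smul γ m hx
  obtain ⟨hf, hmk⟩ := zpowElem_smul_mk hd hγ (-m) hw
  exact hAP hm hPw hf (by rw [← hmk, h1]; exact hxK)

end QuatProj

namespace QuatProj

variable {k l : ℕ}

/-! ### Recurrence on the subspace where the powers are bounded -/

/-- On such vectors the powers act through `g ^ m` in a product of unit spheres of `ℍ`, a compact
group, where the powers of any element accumulate at `1`. -/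
theorem frequently_flow_mem {d : Fin k → ℍ[ℝ]} (hd : ∀ i, ‖d i‖ = 1) {v : Fin (k + l) → ℍ[ℝ]}
    (hv : ∀ t : Fin l, 0 < (t : ℕ) → v (Fin.natAdd k t) = 0) {P : (Fin (k + l) → ℍ[ℝ]) → Prop}
    (hP : ∀ᶠ w in 𝓝 v, P w) : ∃ᶠ m : ℤ in cofinite, P (flow d m v) := by
  let g : Fin k → Metric.sphere (0 : ℍ[ℝ]) 1 := fun i => ⟨d i, by simp [hd i]⟩
  let Φ : (Fin k → Metric.sphere (0 : ℍ[ℝ]) 1) → Fin (k + l) → ℍ[ℝ] := fun a =>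
    Fin.addCases (fun i => (a i : ℍ[ℝ]) * v (Fin.castAdd l i)) (fun i => v (Fin.natAdd k i))
  have hΦ : Continuous Φ := by
    refine continuous_pi fun i => Fin.addCases (fun i => ?_) (fun i => ?_) i
    · simp only [Φ, Fin.addCases_left]
      exact (continuous_subtype_val.comp (continuous_apply i)).mul continuous_const
    · simp only [Φ, Fin.addCases_right]
      exact continuous_const
  have hΦ1 : Φ 1 = v := by
    funext i
    refine Fin.addCases (fun i => ?_) (fun i => ?_) i <;> simp [Φ]
  have hΦg : ∀ m : ℕ, Φ (g ^ m) = flow d m v := by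
    intro m
    funext i
    refine Fin.addCases (fun i => ?_) (fun i => ?_) i
    · simp [Φ, g]
    · have h0 : ∀ t : Fin l, i < t → v (Fin.natAdd k t) = 0 := fun t ht =>
        hv t (lt_of_le_of_lt (Nat.zero_le _) ht)
      rw [flow_natAdd_top h0]
      simp [Φ]
  have hcl := (mapClusterPt_one_atTop_pow g).frequently
    (p := fun a => P (Φ a)) (hΦ.continuousAt.eventually (by rwa [hΦ1]))
  simp only [hΦg] at hcl
  have hcast : Tendsto (fun m : ℕ => (m : ℤ)) atTop cofinite := by
    rw [← Nat.cofinite_eq_atTop]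
    exact Nat.cast_injective.tendsto_cofinite
  exact hcast.frequently hcl

theorem coordSubspace_subset_L0_union_L1 (hl : 2 ≤ l) {d : Fin k → ℍ[ℝ]} (hd : ∀ i, ‖d i‖ = 1)
    {γ : SL (k + l)} (hγ : toMat γ = diagJordan d l) :
    (coordSubspace (k + l) (k + 1) : Set (Space (k + l))) ⊆
      Kulkarni.L0 (Subgroup.zpowers (γ : PSL (k + l))) (Space (k + l)) ∪
      Kulkarni.L1 (Subgroup.zpowers (γ : PSL (k + l))) (Space (k + l)) := by
  intro p hp
  by_cases hp0 : p ∈ Kulkarni.L0 (Subgroup.zpowers (γ : PSL (k + l))) (Space (k + l))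
  · exact Or.inl hp0
  refine Or.inr (subset_closure ⟨p, hp0, ?_⟩)
  rw [isClusterPoint_iff hl hd hγ]
  intro U hU
  induction p using Projectivization.ind with
  | h v hv =>
  refine (frequently_flow_mem hd (fun t ht => hp _ (by simp; omega))
    (mk_mem_of_mem_nhds hv hU)).mono fun m hm => ?_
  obtain ⟨hf, hmk⟩ := zpowElem_smul_mk hd hγ m hv
  exact ⟨_, hm hf, hmk.symm⟩

/-! ### Points reached from compact sets -/

theorem isCompact_mk {n : ℕ} (i : Fin n) {ε : ℝ} (hε : 0 < ε) (R : ℝ) :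
    IsCompact {p : Space n | ∃ x, ∃ hx : x ≠ 0, (ε ≤ ‖x i‖ ∧ ‖x‖ ≤ R) ∧
      p = Projectivization.mk (ℍ[ℝ])ᵐᵒᵖ x hx} := by
  have hS : IsCompact {x : Fin n → ℍ[ℝ] | ε ≤ ‖x i‖ ∧ ‖x‖ ≤ R} := by
    refine (isCompact_closedBall (0 : Fin n → ℍ[ℝ]) R).of_isClosed_subset ?_ ?_
    · exact (isClosed_le continuous_const (continuous_apply i).norm).inter
        (isClosed_le continuous_norm continuous_const)
    · exact fun x hx => by simpa using hx.2
  have hS' : IsCompact {x : {v : Fin n → ℍ[ℝ] // v ≠ 0} | ε ≤ ‖x.1 i‖ ∧ ‖x.1‖ ≤ R} := by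
    rw [Subtype.isCompact_iff]
    convert hS using 1
    ext x
    refine ⟨?_, fun hx => ⟨⟨x, ?_⟩, hx, rfl⟩⟩
    · rintro ⟨y, hy, rfl⟩
      exact hy
    · rintro rfl
      have := hx.1
      rw [Pi.zero_apply, norm_zero] at this
      linarith
  convert hS'.image continuous_mk' using 1
  ext p
  constructor
  · rintro ⟨x, hx, h, rfl⟩
    exact ⟨⟨x, hx⟩, h, rfl⟩
  · rintro ⟨⟨x, hx⟩, h, rfl⟩
    exact ⟨x, hx, h, rfl⟩

variable {r : ℕ}

/-- The last coordinate for which the `m`-th power annihilates the first coordinate of the Jordan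
block. -/
noncomputable def lastCorrection (v : Fin (k + (r + 3)) → ℍ[ℝ]) (m : ℤ) : ℍ[ℝ] :=
  -((unipotentEntry m 0 (r + 2))⁻¹ •
    ∑ t : Fin (r + 3), unipotentEntry m 0 t • v (Fin.natAdd k t))

/-- The vector `v` with `lastCorrection` added to its last coordinate. -/
noncomputable def corrected (v : Fin (k + (r + 3)) → ℍ[ℝ]) (m : ℤ) : Fin (k + (r + 3)) → ℍ[ℝ] :=
  v + Pi.single (Fin.natAdd k (Fin.last (r + 2))) (lastCorrection v m)

theorem tendsto_sum_unipotentEntry {v : Fin (k + (r + 3)) → ℍ[ℝ]}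
    (hv : v (Fin.natAdd k (Fin.last (r + 2))) = 0) {i s : ℕ} (his : s + i = r + 1 ∨ r + 1 < s + i) :
    Tendsto (fun m : ℤ => ∑ t : Fin (r + 3), (unipotentEntry m i t / (m : ℝ) ^ s) •
      v (Fin.natAdd k t)) cofinite (𝓝 (if s + i = r + 1 then
        (s.factorial : ℝ)⁻¹ • v (Fin.natAdd k (Fin.last (r + 1)).castSucc) else 0)) := by
  have hterm : ∀ t : Fin (r + 3), Tendsto (fun m : ℤ => (unipotentEntry m i t / (m : ℝ) ^ s) •
      v (Fin.natAdd k t)) cofinite (𝓝 (if t = (Fin.last (r + 1)).castSucc then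
        (if s + i = r + 1 then (s.factorial : ℝ)⁻¹ •
          v (Fin.natAdd k (Fin.last (r + 1)).castSucc) else 0) else 0)) := by
    intro t
    by_cases ht : t = Fin.last (r + 2)
    · subst ht
      rw [if_neg (by simp [Fin.ext_iff])]
      simp only [hv, smul_zero]
      exact tendsto_const_nhds
    · have ht' : (t : ℕ) < r + 2 := by
        rw [Fin.ext_iff, Fin.val_last] at ht
        omega
      refine (((tendsto_unipotentEntry_div_pow (i := i) (t := t) (s := s) (by omega)).comp
        tendsto_intCast_cobounded).smul_const (v (Fin.natAdd k t))).trans_eq (congrArg 𝓝 ?_)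
      by_cases h1 : t = (Fin.last (r + 1)).castSucc
      · subst h1
        by_cases h2 : s + i = r + 1 <;> simp [h2, eq_comm (a := r + 1)]
      · rw [if_neg h1, if_neg, zero_smul]
        rw [Fin.ext_iff] at h1
        simp only [Fin.val_castSucc, Fin.val_last] at h1
        omega
  have hsum := tendsto_finsetSum Finset.univ fun t _ => hterm t
  rwa [Finset.sum_ite_eq' Finset.univ, if_pos (Finset.mem_univ _)] at hsum

/-- The sum grows like `m ^ (r + 1) / (r + 1)!` and its divisor like `m ^ (r + 2) / (r + 2)!`; the
factor `r + 2` is the quotient of the factorials. -/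
theorem tendsto_mul_lastCorrection {v : Fin (k + (r + 3)) → ℍ[ℝ]}
    (hv : v (Fin.natAdd k (Fin.last (r + 2))) = 0) :
    Tendsto (fun m : ℤ => (m : ℝ) • lastCorrection v m) cofinite
      (𝓝 (-((r + 2 : ℝ) • v (Fin.natAdd k (Fin.last (r + 1)).castSucc)))) := by
  have h1 := ((tendsto_unipotentEntry_div_pow (i := 0) (t := r + 2) (s := r + 2) le_rfl).comp
    tendsto_intCast_cobounded).inv₀ (by simp; positivity)
  have h2 := (h1.smul (tendsto_sum_unipotentEntry hv (i := 0) (s := r + 1) (Or.inl rfl))).neg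
  refine (h2.congr' ?_).trans_eq (congrArg 𝓝 ?_)
  · filter_upwards [eventually_cofinite_ne 0] with m hm
    have hm' : (m : ℝ) ≠ 0 := Int.cast_ne_zero.mpr hm
    simp only [lastCorrection, smul_neg, Finset.smul_sum, smul_smul, Function.comp_apply]
    congr 1
    refine Finset.sum_congr rfl fun t _ => ?_
    congr 1
    rw [inv_div]
    field_simp
    ring
  · simp only [add_zero, if_true, inv_inv, smul_smul]
    congr 2
    rw [Nat.factorial_succ (r + 1)]
    push_cast
    field_simp
    ring

theorem tendsto_corrected {v : Fin (k + (r + 3)) → ℍ[ℝ]}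
    (hv : v (Fin.natAdd k (Fin.last (r + 2))) = 0) :
    Tendsto (corrected v) cofinite (𝓝 v) := by
  have h1 := ((tendsto_inv₀_cobounded (α := ℝ)).comp tendsto_intCast_cobounded).smul
    (tendsto_mul_lastCorrection hv)
  rw [zero_smul] at h1
  have h2 : Tendsto (lastCorrection v) cofinite (𝓝 0) := by
    refine h1.congr' ?_
    filter_upwards [eventually_cofinite_ne 0] with m hm
    rw [Function.comp_apply, inv_smul_smul₀ (Int.cast_ne_zero.mpr hm)]
  have h3 : Tendsto (fun m => v + Pi.single (Fin.natAdd k (Fin.last (r + 2))) (lastCorrection v m))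
      cofinite (𝓝 (v + Pi.single (Fin.natAdd k (Fin.last (r + 2))) 0)) :=
    tendsto_const_nhds.add (((continuous_single _).tendsto 0).comp h2)
  rw [Pi.single_zero, add_zero] at h3
  exact h3

theorem flow_corrected (d : Fin k → ℍ[ℝ]) (v : Fin (k + (r + 3)) → ℍ[ℝ]) (m : ℤ)
    (i : Fin (r + 3)) : flow d m (corrected v m) (Fin.natAdd k i) =
      ∑ t : Fin (r + 3), unipotentEntry m i t • v (Fin.natAdd k t) +
        unipotentEntry m i (r + 2) • lastCorrection v m := by
  have h : ∀ t : Fin (r + 3), corrected v m (Fin.natAdd k t) =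
      v (Fin.natAdd k t) + if t = Fin.last (r + 2) then lastCorrection v m else 0 := by
    intro t
    rw [corrected, Pi.add_apply, Pi.single_apply]
    simp only [(Fin.natAdd_injective _ k).eq_iff]
  simp only [flow_natAdd, h, smul_add, Finset.sum_add_distrib, smul_ite, smul_zero]
  rw [Finset.sum_ite_eq' Finset.univ, if_pos (Finset.mem_univ _), Fin.val_last]

/-- In row `1` both the original vector and the correction contribute at order `m ^ r`, with
coefficients `1 / r!` and `-(r + 2) / (r + 1)!`. Their sum `-1 / (r + 1)!` is nonzero, which keeps
the images away from `V`. Later rows grow more slowly. -/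
theorem tendsto_flow_corrected (d : Fin k → ℍ[ℝ]) {v : Fin (k + (r + 3)) → ℍ[ℝ]}
    (hv : v (Fin.natAdd k (Fin.last (r + 2))) = 0) {i : Fin (r + 3)} (hi : 0 < (i : ℕ)) :
    Tendsto (fun m : ℤ => ((m : ℝ) ^ r)⁻¹ • flow d m (corrected v m) (Fin.natAdd k i)) cofinite
      (𝓝 (if (i : ℕ) = 1 then -((((r + 1).factorial : ℝ)⁻¹) •
        v (Fin.natAdd k (Fin.last (r + 1)).castSucc)) else 0)) := by
  have h1 := tendsto_sum_unipotentEntry hv (i := i) (s := r) (by omega)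
  have h2 := ((tendsto_unipotentEntry_div_pow (i := i) (t := r + 2) (s := r + 1) (by omega)).comp
    tendsto_intCast_cobounded).smul (tendsto_mul_lastCorrection hv)
  refine ((h1.add h2).congr' ?_).trans_eq (congrArg 𝓝 ?_)
  · filter_upwards [eventually_cofinite_ne 0] with m hm
    have hm' : (m : ℝ) ≠ 0 := Int.cast_ne_zero.mpr hm
    rw [flow_corrected, smul_add, Finset.smul_sum]
    simp only [smul_smul, Function.comp_apply]
    congr 1
    · refine Finset.sum_congr rfl fun t _ => ?_
      rw [div_eq_inv_mul]
    · congr 1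
      field_simp
      ring
  · by_cases h : (i : ℕ) = 1
    · rw [if_pos (by omega), if_pos (by omega), if_pos h, smul_neg, smul_smul, ← sub_eq_add_neg,
        ← sub_smul, ← neg_smul]
      congr 1
      rw [Nat.factorial_succ r]
      push_cast
      field_simp
      ring
    · rw [if_neg (by omega), if_neg (by omega), if_neg h, zero_smul, add_zero]

theorem eventually_flow_corrected_eq_zero (d : Fin k → ℍ[ℝ]) (v : Fin (k + (r + 3)) → ℍ[ℝ]) :
    ∀ᶠ m : ℤ in cofinite, flow d m (corrected v m) (Fin.natAdd k 0) = 0 := by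
  have h1 := (tendsto_unipotentEntry_div_pow (i := 0) (t := r + 2) (s := r + 2) le_rfl).comp
    tendsto_intCast_cobounded
  filter_upwards [h1.eventually_ne (b₂ := 0) (by simp; positivity)] with m hm
  have hne : unipotentEntry m 0 (r + 2) ≠ 0 := fun h => hm (by simp [h])
  rw [flow_corrected, lastCorrection, smul_neg, Fin.val_zero, smul_inv_smul₀ hne, add_neg_cancel]

/-- Only a bound is sought: for `r = 0` the diagonal coordinates are not scaled down and may keep
rotating. -/
theorem exists_norm_flow_corrected_le {d : Fin k → ℍ[ℝ]} (hd : ∀ i, ‖d i‖ = 1)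
    {v : Fin (k + (r + 3)) → ℍ[ℝ]} (hv : v (Fin.natAdd k (Fin.last (r + 2))) = 0) :
    ∃ R : ℝ, ∀ᶠ m : ℤ in cofinite, ‖((m : ℝ) ^ r)⁻¹ • flow d m (corrected v m)‖ ≤ R := by
  have hcoord : ∀ i, ∃ R : ℝ, ∀ᶠ m : ℤ in cofinite,
      ‖(((m : ℝ) ^ r)⁻¹ • flow d m (corrected v m)) i‖ ≤ R := by
    refine Fin.addCases (fun i => ?_) (fun i => ?_)
    · refine ⟨‖v (Fin.castAdd (r + 3) i)‖, ?_⟩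
      filter_upwards [eventually_cofinite_ne 0] with m hm
      have h1 : (1 : ℝ) ≤ |(m : ℝ)| := by exact_mod_cast Int.one_le_abs hm
      rw [Pi.smul_apply, flow_castAdd, norm_smul, norm_zpow_mul (hd i), corrected, Pi.add_apply,
        Pi.single_eq_of_ne (by simp [Fin.ext_iff]; omega), add_zero, norm_inv, norm_pow,
        Real.norm_eq_abs]
      exact mul_le_of_le_one_left (norm_nonneg _) (inv_le_one_of_one_le₀ (one_le_pow₀ h1))
    · by_cases hi : 0 < (i : ℕ)
      · exact ⟨_, ((tendsto_flow_corrected d hv hi).norm.eventually_lt_const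
          (lt_add_one _)).mono fun m hm => hm.le⟩
      · refine ⟨0, ?_⟩
        obtain rfl : i = 0 := Fin.ext (by simpa using hi)
        filter_upwards [eventually_flow_corrected_eq_zero d v] with m hm
        rw [Pi.smul_apply, hm, smul_zero, norm_zero]
  choose R hR using hcoord
  refine ⟨∑ i, |R i|, ?_⟩
  filter_upwards [eventually_all.mpr hR] with m hm
  refine (pi_norm_le_iff_of_nonneg (Finset.sum_nonneg fun i _ => abs_nonneg _)).mpr fun i => ?_
  exact (hm i).trans ((le_abs_self _).trans
    (Finset.single_le_sum (f := fun i => |R i|) (fun i _ => abs_nonneg _) (Finset.mem_univ i)))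

theorem exists_isCompact_flow_corrected {d : Fin k → ℍ[ℝ]} (hd : ∀ i, ‖d i‖ = 1)
    {v : Fin (k + (r + 3)) → ℍ[ℝ]} (hv : v (Fin.natAdd k (Fin.last (r + 2))) = 0)
    (hv' : v (Fin.natAdd k (Fin.last (r + 1)).castSucc) ≠ 0) :
    ∃ K : Set (Space (k + (r + 3))), IsCompact K ∧
      K ⊆ (coordSubspace (k + (r + 3)) (k + 1) : Set (Space (k + (r + 3))))ᶜ ∧
      ∀ᶠ m : ℤ in cofinite, ∀ h : flow d m (corrected v m) ≠ 0,
        (Projectivization.mk (ℍ[ℝ])ᵐᵒᵖ (flow d m (corrected v m)) h : Space (k + (r + 3))) ∈ K := by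
  obtain ⟨R, hR⟩ := exists_norm_flow_corrected_le hd hv
  have hlim := (tendsto_flow_corrected d hv (i := 1) (by simp)).norm
  rw [if_pos (by simp), norm_neg] at hlim
  set a := ‖(((r + 1).factorial : ℝ)⁻¹) • v (Fin.natAdd k (Fin.last (r + 1)).castSucc)‖
  have ha : 0 < a := norm_pos_iff.mpr (smul_ne_zero (by positivity) hv')
  -- The coordinate after `e_{k+1}` vanishes on `V`, while on the rescaled images its norm tends to
  -- `a`, so a lower bound `a / 2` separates `K` from `V`.
  refine ⟨_, isCompact_mk (Fin.natAdd k (1 : Fin (r + 3))) (half_pos ha) R, ?_, ?_⟩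
  · rintro _ ⟨x, hx, ⟨h1, -⟩, rfl⟩ h2
    rw [SetLike.mem_coe, mk_mem_coordSubspace] at h2
    rw [h2 _ (by simp), norm_zero] at h1
    linarith
  · filter_upwards [hR, hlim.eventually_const_lt (half_lt_self ha), eventually_cofinite_ne 0]
      with m h1 h2 hm h
    have hs : ((m : ℝ) ^ r)⁻¹ • flow d m (corrected v m) ≠ 0 :=
      smul_ne_zero (inv_ne_zero (pow_ne_zero _ (Int.cast_ne_zero.mpr hm))) h
    exact ⟨_, hs, ⟨h2.le, h1⟩, (mk_real_smul h hs).symm⟩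

theorem mk_mem_L2 {d : Fin k → ℍ[ℝ]} (hd : ∀ i, ‖d i‖ = 1) {γ : SL (k + (r + 3))}
    (hγ : toMat γ = diagJordan d (r + 3)) {v : Fin (k + (r + 3)) → ℍ[ℝ]} (hv0 : v ≠ 0)
    (hv : v (Fin.natAdd k (Fin.last (r + 2))) = 0)
    (hv' : v (Fin.natAdd k (Fin.last (r + 1)).castSucc) ≠ 0) :
    Projectivization.mk (ℍ[ℝ])ᵐᵒᵖ v hv0 ∈
      Kulkarni.L2 (Subgroup.zpowers (γ : PSL (k + (r + 3)))) (Space (k + (r + 3))) := by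
  obtain ⟨K, hK, hKV, hev⟩ := exists_isCompact_flow_corrected hd hv hv'
  refine subset_closure ⟨K, hK, hKV.trans (Set.compl_subset_compl.mpr
    (Set.union_subset (L0_subset d hd hγ) (L1_subset (by omega) hd hγ))), ?_⟩
  rw [isClusterPoint_iff (by omega) hd hγ]
  intro U hU
  have hy := tendsto_corrected hv
  have hall : ∀ᶠ m : ℤ in cofinite, (U ∩ (fun x => zpowElem γ (-m) • x) '' K).Nonempty := by
    filter_upwards [hev, hy.eventually (mk_mem_of_mem_nhds hv0 hU), hy.eventually_ne hv0]
      with m h1 h2 h3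
    obtain ⟨hf, hmk⟩ := zpowElem_smul_mk hd hγ m h3
    exact ⟨_, h2 h3, _, h1 hf, zpowElem_neg_smul γ m hmk⟩
  exact (neg_injective.tendsto_cofinite (α := ℤ)).frequently hall.frequently

theorem coordSubspace_subset_L2 {d : Fin k → ℍ[ℝ]} (hd : ∀ i, ‖d i‖ = 1) {γ : SL (k + (r + 3))}
    (hγ : toMat γ = diagJordan d (r + 3)) :
    (coordSubspace (k + (r + 3)) (k + (r + 3) - 1) : Set (Space (k + (r + 3)))) ⊆
      Kulkarni.L2 (Subgroup.zpowers (γ : PSL (k + (r + 3)))) (Space (k + (r + 3))) := by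
  intro p hp
  induction p using Projectivization.ind with
  | h v hv =>
  have hlast : v (Fin.natAdd k (Fin.last (r + 2))) = 0 := hp _ (by simp)
  by_cases hv' : v (Fin.natAdd k (Fin.last (r + 1)).castSucc) = 0
  swap
  · exact mk_mem_L2 hd hγ hv hlast hv'
  refine isClosed_closure.closure_subset (mem_closure_iff_nhds.mpr fun U hU => ?_)
  -- Adding a small nonzero real `s` to a vanishing penultimate coordinate approximates the point by
  -- points already known to lie in the closed set `L2`.
  have hlim : Tendsto (fun s : ℝ => v + Pi.single (Fin.natAdd k (Fin.last (r + 1)).castSucc)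
      (s : ℍ[ℝ])) (𝓝[≠] 0) (𝓝 v) := by
    have hc : Continuous (fun s : ℝ => v + Pi.single (Fin.natAdd k (Fin.last (r + 1)).castSucc)
        (s : ℍ[ℝ])) :=
      continuous_const.add ((continuous_single _).comp Quaternion.continuous_coe)
    have := hc.tendsto 0
    simp only [Quaternion.coe_zero, Pi.single_zero, add_zero] at this
    exact this.mono_left nhdsWithin_le_nhds
  obtain ⟨s, hs, hU', hne⟩ := ((eventually_mem_nhdsWithin (s := {(0 : ℝ)}ᶜ)).and
    ((hlim.eventually (mk_mem_of_mem_nhds hv hU)).and (hlim.eventually_ne hv))).exists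
  refine ⟨_, hU' hne, mk_mem_L2 hd hγ hne ?_ ?_⟩
  · rw [Pi.add_apply, hlast, Pi.single_eq_of_ne (by simp [Fin.ext_iff]), add_zero]
  · rw [Pi.add_apply, hv', zero_add, Pi.single_eq_same]
    exact fun h => hs (Quaternion.coe_injective (h.trans Quaternion.coe_zero.symm))

end QuatProj

theorem mainTheorem3 (k l : ℕ) (hl : 2 ≤ l) (d : Fin k → ℍ[ℝ]) (hd : ∀ i, ‖d i‖ = 1)
    (γt : QuatProj.PSL (k + l)) (γ : QuatProj.SL (k + l))
    (hlift : (γ : QuatProj.PSL (k + l)) = γt)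
    (hγ : QuatProj.toMat γ = QuatProj.diagJordan d l) :
    Kulkarni.limitSet (Subgroup.zpowers γt) (QuatProj.Space (k + l)) =
      (Projectivization.Subspace.span
        {p : QuatProj.Space (k + l) | ∃ i : Fin (k + l), (i : ℕ) + 1 < k + l ∧
          p = QuatProj.stdPoint i} : Set (QuatProj.Space (k + l))) := by
  subst hlift
  rw [QuatProj.span_stdPoint]
  have hmono := QuatProj.coordSubspace_mono (n := k + l) (show k + 1 ≤ k + l - 1 by omega)
  refine Set.Subset.antisymm (Set.union_subset (Set.union_subset
    ((QuatProj.L0_subset d hd hγ).trans hmono) ((QuatProj.L1_subset hl hd hγ).trans hmono))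
    (QuatProj.L2_subset hl hd hγ)) ?_
  -- For `l = 2` the numbers `k + 1` and `k + l - 1` agree, so recurrence alone suffices; the
  -- correction argument needs a Jordan coordinate strictly between the first and the last.
  rcases hl.eq_or_lt with rfl | hl3
  · exact (QuatProj.coordSubspace_subset_L0_union_L1 le_rfl hd hγ).trans Set.subset_union_left
  · obtain ⟨r, rfl⟩ := Nat.exists_eq_add_of_le' hl3
    exact (QuatProj.coordSubspace_subset_L2 hd hγ).trans Set.subset_union_right
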